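/- Let $n\ge 2$, let $e_1,\dots,e_n$ be the standard basis of Euclidean space $\mathbb R^n$, and consider the root system of type $\mathsf C_n$ (roots $\pm e_i\pm e_j$ for $i\ne j$, and $\pm 2e_i$) with simple roots $\alpha_i=e_i-e_{i+1}$ $(1\le i\le n-1)$, $\alpha_n=2e_n$, highest root $\theta=2e_1$, and coroots $\alpha^\vee=2\alpha/(\alpha,\alpha)$. Let $W_0$ be its Weyl group, $P^\vee$ its coweight lattice (the weight lattice of the dual root system, of type $\mathsf B_n$), and let $\widetilde W=W_0\ltimes P^\vee$ be the extended affine Weyl group of type $\mathsf C_n^{(1)}$, where $p\in P^\vee$ is also written as the translation $t_p$. Let $s_1,\dots,s_n$ be the simple reflections of $W_0$ and $s_0=t_{\theta^\vee}s_\theta$. The group $\widetilde W$ acts on $\mathbb R^n$ by affine transformations, and hence on affine functions; with $\delta=1$ and $\alpha_0=\delta-\theta$, let $\Lambda\subset\widetilde W$ be the group of those elements that permute the simple affine roots $\{\alpha_0,\dots,\alpha_n\}$. Let $\omega_i\in\widetilde W$ $(1\le i\le n)$ be the translation by the $i$-th fundamental coweight, i.e. by $e_1+\dots+e_i$ if $i<n$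 and by $\frac12(e_1+\dots+e_n)$ if $i=n$. For $1\le k\le l\le n$ put $[k,l]=s_ks_{k+1}\cdots s_l$. An expression $w=\lambda s_{i_1}\cdots s_{i_r}$ with $\lambda\in\Lambda$ and $i_1,\dots,i_r\in\{0,\dots,n\}$ is called reduced if $r$ is minimal among all such expressions of $w$. Then there is a unique $\pi_n\in\widetilde W$ such that $\pi_n(\alpha_k)=\alpha_{n-k}$ for all $0\le k\le n$; it lies in $\Lambda$, and $$\omega_n=\pi_n\, s_n\,[n-1,n]\cdots[2,n]\,[1,n],$$ while for $1\le i<n$ $$\omega_i=(s_0[1,n])^i\,[n-i,n-1]\cdots[2,i+1]\,[1,i].$$ Moreover, these formulae yield reduced expressions (for $i<n$ with $\lambda=1$, and for $i=n$ with $\lambda=\pi_n$). -/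

import Mathlib

namespace TypeC

/-- The Euclidean space `ℝⁿ`, identified with its dual by the standard scalar product `dotProduct`. -/
abbrev V (n : ℕ) : Type := Fin n → ℝ

/-- The standard basis vector `e_j`, with `1`-based labels `1 ≤ j ≤ n`. -/
def e (n j : ℕ) : V n := fun m => if m.val + 1 = j then 1 else 0

/-- The root system of type `C_n`: the vectors `± e_i ± e_j` with `i ≠ j`, and `± 2 e_i`. -/
def roots (n : ℕ) : Set (V n) :=
  {v | (∃ i j : ℕ, 1 ≤ i ∧ i ≤ n ∧ 1 ≤ j ∧ j ≤ n ∧ i ≠ j ∧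
          (v = e n i - e n j ∨ v = e n i + e n j ∨ v = -(e n i + e n j))) ∨
       (∃ i : ℕ, 1 ≤ i ∧ i ≤ n ∧ (v = (2 : ℝ) • e n i ∨ v = -((2 : ℝ) • e n i)))}

/-- The simple roots `α_i`, `1 ≤ i ≤ n`: `α_i = e_i - e_{i+1}` for `i < n`, and `α_n = 2 e_n`. -/
def simpleRoot (n i : ℕ) : V n :=
  if i < n then e n i - e n (i + 1) else (2 : ℝ) • e n n

/-- The highest root `θ = 2 α_1 + ⋯ + 2 α_{n-1} + α_n = 2 e_1`. -/
def highestRoot (n : ℕ) : V n := (2 : ℝ) • e n 1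

/-- The coroot `α^∨ = 2 α / (α, α)`. -/
noncomputable def coroot {n : ℕ} (α : V n) : V n := (2 / dotProduct α α) • α

/-- The reflection `x ↦ x - (α, x) α^∨`. -/
noncomputable def reflection {n : ℕ} (α : V n) : V n ≃ₗ[ℝ] V n :=
  LinearEquiv.ofInvolutive
    { toFun := fun x => x - dotProduct α x • coroot α
      map_add' := fun x y => by rw [dotProduct_add, add_smul]; abel
      map_smul' := fun c x => by
        rw [dotProduct_smul, RingHom.id_apply, smul_sub, smul_smul, smul_eq_mul] }
    (fun x => by
      by_cases h : dotProduct α α = 0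
      · simp [coroot, h]
      · have h2 : dotProduct α (coroot α) = 2 := by
          rw [coroot, dotProduct_smul, smul_eq_mul]; field_simp
        change (x - dotProduct α x • coroot α) -
          dotProduct α (x - dotProduct α x • coroot α) • coroot α = x
        rw [dotProduct_sub, dotProduct_smul, h2, smul_eq_mul, ← sub_eq_zero]
        module)

theorem reflection_apply {n : ℕ} (α x : V n) :
    reflection α x = x - dotProduct α x • coroot α := rfl

/-- The finite Weyl group `W_0`. -/
def weylGroup (n : ℕ) : Subgroup (V n ≃ₗ[ℝ] V n) :=
  Subgroup.closure (reflection '' roots n)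

/-- The coweight lattice `P^∨`, i.e. the weight lattice of the dual root system (of type `B_n`). -/
def coweightLattice (n : ℕ) : AddSubgroup (V n) where
  carrier := {p | ∀ α ∈ roots n, ∃ m : ℤ, dotProduct α p = m}
  zero_mem' := fun α _ => ⟨0, by simp⟩
  add_mem' := fun {p q} hp hq α hα => by
    obtain ⟨a, ha⟩ := hp α hα
    obtain ⟨b, hb⟩ := hq α hα
    exact ⟨a + b, by rw [dotProduct_add, ha, hb]; push_cast; rfl⟩
  neg_mem' := fun {p} hp α hα => by
    obtain ⟨a, ha⟩ := hp α hα
    exact ⟨-a, by rw [dotProduct_neg, ha]; push_cast; rfl⟩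

theorem e_dotProduct {n j : ℕ} (h1 : 1 ≤ j) (h2 : j ≤ n) (x : V n) :
    dotProduct (e n j) x = x ⟨j - 1, by omega⟩ := by
  rw [dotProduct, Finset.sum_eq_single (⟨j - 1, by omega⟩ : Fin n)]
  · have : j - 1 + 1 = j := by omega
    simp [e, this]
  · intro b _ hb
    have : ¬ (b.val + 1 = j) := fun h => hb (Fin.ext (by simp; omega))
    simp [e, this]
  · simp

theorem mem_coweightLattice {n : ℕ} (p : V n)
    (h : ∀ i j : Fin n, ∃ m : ℤ, p i + p j = m) : p ∈ coweightLattice n := by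
  rintro α (⟨i, j, hi, hi', hj, hj', -, h'⟩ | ⟨i, hi, hi', h'⟩)
  · obtain ⟨a, ha⟩ := h ⟨i - 1, by omega⟩ ⟨j - 1, by omega⟩
    obtain ⟨b, hb⟩ := h ⟨j - 1, by omega⟩ ⟨j - 1, by omega⟩
    rcases h' with rfl | rfl | rfl
    · exact ⟨a - b, by
        rw [sub_dotProduct, e_dotProduct hi hi', e_dotProduct hj hj']; push_cast; linarith⟩
    · exact ⟨a, by rw [add_dotProduct, e_dotProduct hi hi', e_dotProduct hj hj', ha]⟩
    · exact ⟨-a, by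
        rw [neg_dotProduct, add_dotProduct, e_dotProduct hi hi', e_dotProduct hj hj', ha]
        push_cast; rfl⟩
  · obtain ⟨a, ha⟩ := h ⟨i - 1, by omega⟩ ⟨i - 1, by omega⟩
    rcases h' with rfl | rfl
    · exact ⟨a, by rw [smul_dotProduct, e_dotProduct hi hi', smul_eq_mul]; linarith⟩
    · exact ⟨-a, by
        rw [neg_dotProduct, smul_dotProduct, e_dotProduct hi hi', smul_eq_mul]
        push_cast; linarith⟩

theorem e_apply_int (n j : ℕ) (m : Fin n) : ∃ k : ℤ, e n j m = k := by
  unfold e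
  split_ifs
  · exact ⟨1, by simp⟩
  · exact ⟨0, by simp⟩

theorem coroot_apply_int {n : ℕ} {α : V n} (hα : α ∈ roots n) (m : Fin n) :
    ∃ k : ℤ, coroot α m = k := by
  have he : ∀ i j : ℕ, 1 ≤ i → i ≤ n → dotProduct (e n i) (e n j) = if i = j then 1 else 0 := by
    intro i j h1 h2
    rw [e_dotProduct h1 h2]
    have : i - 1 + 1 = i := by omega
    simp [e, this]
  rcases hα with ⟨i, j, hi, hi', hj, hj', hij, h'⟩ | ⟨i, hi, hi', h'⟩
  · obtain ⟨a, ha⟩ := e_apply_int n i m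
    obtain ⟨b, hb⟩ := e_apply_int n j m
    have h1 := he i i hi hi'
    have h2 := he i j hi hi'
    have h3 := he j i hj hj'
    have h4 := he j j hj hj'
    rw [if_pos rfl] at h1 h4
    rw [if_neg hij] at h2
    rw [if_neg (Ne.symm hij)] at h3
    rcases h' with rfl | rfl | rfl
    · refine ⟨a - b, ?_⟩
      simp [coroot, sub_dotProduct, dotProduct_sub, h1, h2, h3, h4, ha, hb]
      norm_num
    · refine ⟨a + b, ?_⟩
      simp [coroot, add_dotProduct, dotProduct_add, h1, h2, h3, h4, ha, hb]
      norm_num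
    · refine ⟨-(a + b), ?_⟩
      simp [coroot, add_dotProduct, dotProduct_add, h1, h2, h3, h4, ha, hb]
      norm_num
      try ring
  · obtain ⟨a, ha⟩ := e_apply_int n i m
    have h1 := he i i hi hi'
    rw [if_pos rfl] at h1
    rcases h' with rfl | rfl
    · refine ⟨a, ?_⟩
      simp [coroot, h1, ha]
    · refine ⟨-a, ?_⟩
      simp [coroot, h1, ha]

theorem coroot_mem {n : ℕ} {α : V n} (hα : α ∈ roots n) : coroot α ∈ coweightLattice n :=
  mem_coweightLattice _ fun i j => by
    obtain ⟨a, ha⟩ := coroot_apply_int hα i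
    obtain ⟨b, hb⟩ := coroot_apply_int hα j
    exact ⟨a + b, by rw [ha, hb]; push_cast; rfl⟩

theorem weylGroup_apply_mem {n : ℕ} {w : V n ≃ₗ[ℝ] V n} (hw : w ∈ weylGroup n) :
    ∀ p ∈ coweightLattice n, w p ∈ coweightLattice n := by
  have key : ∀ α ∈ roots n, ∀ p ∈ coweightLattice n, reflection α p ∈ coweightLattice n := by
    intro α hα p hp
    obtain ⟨a, ha⟩ := hp α hα
    rw [reflection_apply, ha, Int.cast_smul_eq_zsmul]
    exact sub_mem hp (zsmul_mem (coroot_mem hα) a)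
  have hinv : ∀ α : V n, (reflection α)⁻¹ = reflection α := fun α => by
    ext x : 1
    rfl
  refine Subgroup.closure_induction'' (p := fun w _ => ∀ p ∈ coweightLattice n,
    w p ∈ coweightLattice n) ?_ ?_ ?_ ?_ hw
  · rintro _ ⟨α, hα, rfl⟩; exact key α hα
  · rintro _ ⟨α, hα, rfl⟩; rw [hinv]; exact key α hα
  · intro p hp; exact hp
  · intro x y _ _ hx hy p hp; exact hx _ (hy p hp)

/-- The action of `W_0` on `P^∨` (written multiplicatively). -/
def weylAction (n : ℕ) : weylGroup n →* MulAut (Multiplicative (coweightLattice n)) where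
  toFun w := AddEquiv.toMultiplicative
    { toFun := fun p => ⟨w.1 p.1, weylGroup_apply_mem w.2 p.1 p.2⟩
      invFun := fun p => ⟨w⁻¹.1 p.1, weylGroup_apply_mem w⁻¹.2 p.1 p.2⟩
      left_inv := fun p => Subtype.ext (LinearEquiv.symm_apply_apply w.1 p.1)
      right_inv := fun p => Subtype.ext (LinearEquiv.apply_symm_apply w.1 p.1)
      map_add' := fun p q => Subtype.ext (map_add w.1 p.1 q.1) }
  map_one' := rfl
  map_mul' _ _ := rfl

/-- The extended affine Weyl group `W_0 ⋉ P^∨` of type `C_n^(1)`.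
The element `⟨p, w⟩` is `t_p w`, the affine transformation `x ↦ w x + p`. -/
abbrev ExtAffineWeyl (n : ℕ) : Type :=
  Multiplicative (coweightLattice n) ⋊[weylAction n] weylGroup n

/-- The translation `t_p`. -/
def translation {n : ℕ} (p : coweightLattice n) : ExtAffineWeyl n :=
  SemidirectProduct.inl (Multiplicative.ofAdd p)

theorem reflection_mem_weylGroup {n : ℕ} {α : V n} (hα : α ∈ roots n) :
    reflection α ∈ weylGroup n :=
  Subgroup.subset_closure ⟨α, hα, rfl⟩

theorem simpleRoot_mem {n i : ℕ} (h1 : 1 ≤ i) (h2 : i ≤ n) : simpleRoot n i ∈ roots n := by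
  unfold simpleRoot
  split_ifs with h
  · exact Or.inl ⟨i, i + 1, h1, h2, by omega, by omega, by omega, Or.inl rfl⟩
  · exact Or.inr ⟨n, by omega, le_rfl, Or.inl rfl⟩

theorem highestRoot_mem {n : ℕ} (h : 1 ≤ n) : highestRoot n ∈ roots n :=
  Or.inr ⟨1, le_rfl, h, Or.inl rfl⟩

theorem highestRoot_eq {n : ℕ} (h : 1 ≤ n) :
    highestRoot n = simpleRoot n n + (2 : ℝ) • ∑ i ∈ Finset.Ico 1 n, simpleRoot n i := by
  have : ∑ i ∈ Finset.Ico 1 n, simpleRoot n i = e n 1 - e n n := by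
    rw [Finset.sum_congr rfl (g := fun i => -(e n (i + 1) - e n i))]
    · rw [Finset.sum_neg_distrib, Finset.sum_Ico_sub _ h]; abel
    · intro i hi
      rw [simpleRoot, if_pos (Finset.mem_Ico.mp hi).2]; abel
  rw [this, simpleRoot, if_neg (lt_irrefl n), highestRoot]
  module

/-- The simple reflections `s_0, …, s_n`: `s_i` is the reflection in `α_i` for `1 ≤ i ≤ n`, and
`s_0 = t_{θ^∨} s_θ` (for `n ≥ 1`). -/
noncomputable def s {n : ℕ} (i : Fin (n + 1)) : ExtAffineWeyl n :=
  if hn : 1 ≤ n then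
    if hi : i.val = 0 then
      translation ⟨coroot (highestRoot n), coroot_mem (highestRoot_mem hn)⟩ *
        SemidirectProduct.inr
          ⟨reflection (highestRoot n), reflection_mem_weylGroup (highestRoot_mem hn)⟩
    else
      SemidirectProduct.inr
        ⟨reflection (simpleRoot n i.val),
          reflection_mem_weylGroup (simpleRoot_mem (Nat.one_le_iff_ne_zero.mpr hi) i.is_le)⟩
  else 1

/-- The simple affine roots `α_0 = δ - θ, α_1, …, α_n`. A pair `(α, k)` stands for `α + k δ`, that
is, for the affine function `x ↦ (α, x) + k`. -/
def affineSimpleRoot {n : ℕ} (i : Fin (n + 1)) : V n × ℝ :=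
  if i.val = 0 then (-highestRoot n, 1) else (simpleRoot n i.val, 0)

/-- The action of the extended affine Weyl group on affine functions `f` by `g f = f ∘ g⁻¹`; thus
`t_p w (α + k δ) = w α + (k - (w α, p)) δ`. -/
def act {n : ℕ} (g : ExtAffineWeyl n) (f : V n × ℝ) : V n × ℝ :=
  (g.right.1 f.1, f.2 - dotProduct (g.right.1 f.1) (Multiplicative.toAdd g.left).1)

/-- The fundamental group `Λ ≅ P^∨ / Q^∨`, realized as the set of those elements of the extended
affine Weyl group that permute the simple affine roots. -/
def Lam (n : ℕ) : Set (ExtAffineWeyl n) :=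
  {g | act g '' Set.range affineSimpleRoot = Set.range affineSimpleRoot}

/-- The product `s_{i_1} ⋯ s_{i_r}` of a word `i_1 … i_r` in the labels `0, …, n`. -/
noncomputable def wordProd {n : ℕ} (L : List (Fin (n + 1))) : ExtAffineWeyl n := (L.map s).prod

/-- `g = lam s_{i_1} ⋯ s_{i_r}` is a reduced expression of `g`: `lam` lies in `Λ`, and `r` is the
least possible number of simple reflections among all the expressions of `g` of this form, i.e.
`r` is the length of `g`. -/
def IsReducedExpression {n : ℕ} (g lam : ExtAffineWeyl n) (L : List (Fin (n + 1))) : Prop :=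
  lam ∈ Lam n ∧ g = lam * wordProd L ∧
    ∀ lam' ∈ Lam n, ∀ L' : List (Fin (n + 1)), g = lam' * wordProd L' → L.length ≤ L'.length

/-- The element `π_n`, determined by the property that it maps `α_k` to `α_{n-k}`, `0 ≤ k ≤ n`. -/
def IsPi {n : ℕ} (g : ExtAffineWeyl n) : Prop :=
  ∀ k : Fin (n + 1), act g (affineSimpleRoot k) = affineSimpleRoot (Fin.rev k)

/-- The `i`-th fundamental coweight, `1 ≤ i ≤ n`, as a vector: `e_1 + ⋯ + e_i` for `i < n`, and
`(e_1 + ⋯ + e_n) / 2` for `i = n`. -/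
noncomputable def fundamentalCoweightVec (n i : ℕ) : V n :=
  if i < n then ∑ j ∈ Finset.Icc 1 i, e n j else (1 / 2 : ℝ) • ∑ j ∈ Finset.Icc 1 n, e n j

theorem sum_e_apply (n i : ℕ) (m : Fin n) :
    (∑ j ∈ Finset.Icc 1 i, e n j) m = if m.val + 1 ≤ i then 1 else 0 := by
  rw [Finset.sum_apply]
  simp only [e]
  rw [Finset.sum_ite_eq]
  simp

theorem fundamentalCoweightVec_mem (n i : ℕ) :
    fundamentalCoweightVec n i ∈ coweightLattice n := by
  apply mem_coweightLattice
  intro a b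
  unfold fundamentalCoweightVec
  split_ifs with h
  · rw [sum_e_apply, sum_e_apply]
    split_ifs
    · exact ⟨2, by norm_num⟩
    · exact ⟨1, by norm_num⟩
    · exact ⟨1, by norm_num⟩
    · exact ⟨0, by norm_num⟩
  · rw [Pi.smul_apply, Pi.smul_apply, sum_e_apply, sum_e_apply,
      if_pos (Nat.succ_le_of_lt a.isLt), if_pos (Nat.succ_le_of_lt b.isLt)]
    exact ⟨1, by norm_num⟩

/-- The defining property of the fundamental coweights. -/
theorem simpleRoot_dotProduct_fundamentalCoweightVec {n i j : ℕ} (hi' : i ≤ n)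
    (hj : 1 ≤ j) (hj' : j ≤ n) :
    dotProduct (simpleRoot n j) (fundamentalCoweightVec n i) = if i = j then 1 else 0 := by
  have h1 : j - 1 + 1 = j := by omega
  have h2 : n - 1 + 1 = n := by omega
  unfold simpleRoot fundamentalCoweightVec
  by_cases hjn : j < n
  · rw [if_pos hjn, sub_dotProduct, e_dotProduct hj hj', e_dotProduct (by omega) (by omega)]
    by_cases hin : i < n
    · rw [if_pos hin, sum_e_apply, sum_e_apply]
      simp only [h1, Nat.add_sub_cancel]
      split_ifs <;> first | omega | norm_num
    · rw [if_neg hin, Pi.smul_apply, Pi.smul_apply, sum_e_apply, sum_e_apply]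
      simp only [h1, Nat.add_sub_cancel]
      split_ifs <;> first | omega | norm_num
  · rw [if_neg hjn, smul_dotProduct, e_dotProduct (by omega) le_rfl]
    by_cases hin : i < n
    · rw [if_pos hin, sum_e_apply]
      simp only [h2]
      split_ifs <;> first | omega | norm_num
    · rw [if_neg hin, Pi.smul_apply, sum_e_apply]
      simp only [h2]
      split_ifs <;> first | omega | norm_num

/-- The element `ω_i` of the extended affine Weyl group: translation by the `i`-th fundamental
coweight. -/
noncomputable def ω {n : ℕ} (i : ℕ) : ExtAffineWeyl n :=
  translation ⟨fundamentalCoweightVec n i, fundamentalCoweightVec_mem n i⟩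

/-- The word `k, k+1, …, l` of `[k,l] = s_k s_{k+1} ⋯ s_l`, for `1 ≤ k ≤ l ≤ n`. (All the labels are
at most `n`, so that they are not changed by `Fin.ofNat (n + 1)`.) -/
def seg (n k l : ℕ) : List (Fin (n + 1)) :=
  (List.range' k (l + 1 - k)).map (Fin.ofNat (n + 1))

/-- The word of `s_n [n-1,n] ⋯ [2,n] [1,n]`. -/
def wordTop (n : ℕ) : List (Fin (n + 1)) :=
  (List.range n).flatMap fun j => seg n (n - j) n

/-- The word of `(s_0 [1,n])^i [n-i,n-1] ⋯ [2,i+1] [1,i]`. -/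
def wordMid (n i : ℕ) : List (Fin (n + 1)) :=
  (List.replicate i (0 :: seg n 1 n)).flatten ++
    (List.range (n - i)).flatMap fun j => seg n (n - i - j) (n - 1 - j)

end TypeC

/-! The group acts faithfully on `ℝⁿ` by affine maps, so every identity can be checked on
coordinates. There `[k,l]` with `l < n` is a cyclic shift, `[k,n]` a shift with one sign change, and
`s_0 [1,n]` sends `x` to `(x_n + 1, x_1, …, x_{n-1})`. The word for `ω_i` rotates the coordinates
and rotates them back, leaving `1` added to the first `i` of them. The word for `ω_n` is `x_j ↦
-x_{n+1-j}`, which forces `π_n` to be `x_j ↦ 1/2 - x_{n+1-j}`.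

Reducedness comes from a lower bound for lengths. `signedLength g` sums `⌊(α, g x₀)⌋` over the
positive roots `α`, where `x₀ = ρ^∨ / h`. It vanishes on `Λ`, which fixes `x₀`, and right
multiplication by a simple reflection raises it by at most one, since a single hyperplane is crossed
(`signedLength_mul_s_le`). Hence it is at most the number of reflections in any expression. On a
translation `t_p` it equals `(2ρ, p)`, and for the fundamental coweights this is the length of the
given word. -/

namespace TypeC

/-! ### The faithful affine action on `ℝⁿ` -/

/-- The affine transformation `x ↦ w x + p` of `ℝⁿ` defined by `t_p w`. -/
def aff {n : ℕ} (g : ExtAffineWeyl n) (x : V n) : V n :=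
  g.right.1 x + (Multiplicative.toAdd g.left).1

theorem aff_one {n : ℕ} (x : V n) : aff (1 : ExtAffineWeyl n) x = x := by
  change x + 0 = x
  rw [add_zero]

theorem aff_mul {n : ℕ} (g h : ExtAffineWeyl n) (x : V n) : aff (g * h) x = aff g (aff h x) := by
  change g.right.1 (h.right.1 x) + ((Multiplicative.toAdd g.left).1 +
    g.right.1 (Multiplicative.toAdd h.left).1) = g.right.1 (h.right.1 x +
      (Multiplicative.toAdd h.left).1) + (Multiplicative.toAdd g.left).1
  rw [map_add]
  abel

/-- The value at `0` recovers the translation part, and subtracting it recovers the linear part. -/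
theorem aff_injective {n : ℕ} {g h : ExtAffineWeyl n} (H : ∀ x, aff g x = aff h x) : g = h := by
  have h0 := H 0
  simp only [aff, map_zero, zero_add] at h0
  refine SemidirectProduct.ext (Subtype.ext h0) (Subtype.ext (LinearEquiv.ext fun x => ?_))
  have hx := H x
  simp only [aff, h0] at hx
  exact add_right_cancel hx

theorem aff_inv_aff {n : ℕ} (g : ExtAffineWeyl n) (x : V n) : aff g⁻¹ (aff g x) = x := by
  rw [← aff_mul, inv_mul_cancel, aff_one]

theorem aff_aff_inv {n : ℕ} (g : ExtAffineWeyl n) (x : V n) : aff g (aff g⁻¹ x) = x := by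
  rw [← aff_mul, mul_inv_cancel, aff_one]

theorem aff_wordProd_nil {n : ℕ} (x : V n) : aff (wordProd ([] : List (Fin (n + 1)))) x = x := by
  simp [wordProd, aff_one]

theorem aff_wordProd_cons {n : ℕ} (i : Fin (n + 1)) (L : List (Fin (n + 1))) (x : V n) :
    aff (wordProd (i :: L)) x = aff (s i) (aff (wordProd L) x) := by
  simp [wordProd, aff_mul]

theorem aff_wordProd_append {n : ℕ} (L L' : List (Fin (n + 1))) (x : V n) :
    aff (wordProd (L ++ L')) x = aff (wordProd L) (aff (wordProd L') x) := by
  simp [wordProd, aff_mul]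

theorem aff_ω {n : ℕ} (i : ℕ) (x : V n) :
    aff (ω i : ExtAffineWeyl n) x = x + fundamentalCoweightVec n i := rfl

theorem fundamentalCoweightVec_apply_of_lt {n i : ℕ} (h : i < n) (m : Fin n) :
    fundamentalCoweightVec n i m = if m.val < i then 1 else 0 := by
  rw [fundamentalCoweightVec, if_pos h, sum_e_apply]
  rfl

theorem fundamentalCoweightVec_self_apply {n : ℕ} (m : Fin n) :
    fundamentalCoweightVec n n m = 1 / 2 := by
  rw [fundamentalCoweightVec, if_neg (lt_irrefl n), Pi.smul_apply, sum_e_apply,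
    if_pos (Nat.succ_le_of_lt m.isLt)]
  simp

/-! ### Reflections and signed permutations -/

theorem e_val_dotProduct {n : ℕ} (i : Fin n) (x : V n) : dotProduct (e n (i.val + 1)) x = x i :=
  e_dotProduct (by omega) i.isLt x

theorem e_val_apply {n : ℕ} (i m : Fin n) : e n (i.val + 1) m = if m = i then 1 else 0 := by
  simp [e, Fin.ext_iff]

theorem reflection_neg {n : ℕ} (α : V n) : reflection (-α) = reflection α := by
  ext x : 1
  simp [reflection_apply, coroot]

theorem reflection_sub_apply {n : ℕ} {i j : Fin n} (h : i ≠ j) (x : V n) (m : Fin n) :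
    reflection (e n (i.val + 1) - e n (j.val + 1)) x m = x (Equiv.swap i j m) := by
  rw [reflection_apply, coroot, Equiv.swap_apply_def]
  simp only [sub_dotProduct, e_val_dotProduct, Pi.sub_apply, Pi.smul_apply, smul_eq_mul,
    e_val_apply, if_neg h, if_neg h.symm, if_true]
  split_ifs with h1 h2 h2
  · exact absurd (h1.symm.trans h2) h
  · subst h1; norm_num
  · subst h2; norm_num
  · norm_num

theorem reflection_add_apply {n : ℕ} {i j : Fin n} (h : i ≠ j) (x : V n) (m : Fin n) :
    reflection (e n (i.val + 1) + e n (j.val + 1)) x m =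
      (if m = i ∨ m = j then -1 else 1) * x (Equiv.swap i j m) := by
  rw [reflection_apply, coroot, Equiv.swap_apply_def]
  simp only [add_dotProduct, e_val_dotProduct, Pi.sub_apply, Pi.add_apply, Pi.smul_apply,
    smul_eq_mul, e_val_apply, if_neg h, if_neg h.symm]
  by_cases h1 : m = i
  · subst h1; simp [h]; norm_num
  · by_cases h2 : m = j
    · subst h2; simp [h1]; norm_num
    · simp [h1, h2]

theorem reflection_two_smul_apply {n : ℕ} (i : Fin n) (x : V n) (m : Fin n) :
    reflection ((2 : ℝ) • e n (i.val + 1)) x m = if m = i then -x m else x m := by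
  rw [reflection_apply, coroot]
  simp only [smul_dotProduct, dotProduct_smul, e_val_dotProduct, Pi.sub_apply, Pi.smul_apply,
    smul_eq_mul, e_val_apply, if_true]
  split_ifs with h1
  · subst h1; norm_num; ring
  · simp

/-- Every element of `W_0` is a signed permutation of the coordinates. -/
theorem weylGroup_signedPerm {n : ℕ} {w : V n ≃ₗ[ℝ] V n} (hw : w ∈ weylGroup n) :
    ∃ (σ : Equiv.Perm (Fin n)) (ε : Fin n → ℝ), (∀ j, ε j = 1 ∨ ε j = -1) ∧
      ∀ x j, w x j = ε j * x (σ j) := by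
  have key : ∀ α ∈ roots n, ∃ (σ : Equiv.Perm (Fin n)) (ε : Fin n → ℝ),
      (∀ j, ε j = 1 ∨ ε j = -1) ∧ ∀ x j, reflection α x j = ε j * x (σ j) := by
    rintro α (⟨i, j, hi, hi', hj, hj', hij, h⟩ | ⟨i, hi, hi', h⟩)
    · obtain ⟨i, rfl⟩ : ∃ k, i = k + 1 := ⟨i - 1, by omega⟩
      obtain ⟨j, rfl⟩ : ∃ k, j = k + 1 := ⟨j - 1, by omega⟩
      have hne : (⟨i, hi'⟩ : Fin n) ≠ ⟨j, hj'⟩ := fun h => hij (by simpa using h)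
      have h2 : ∃ (σ : Equiv.Perm (Fin n)) (ε : Fin n → ℝ), (∀ j, ε j = 1 ∨ ε j = -1) ∧
          ∀ x m, reflection (e n (i + 1) + e n (j + 1)) x m = ε m * x (σ m) :=
        ⟨Equiv.swap ⟨i, hi'⟩ ⟨j, hj'⟩, _, fun m => by
          split_ifs <;> simp, fun x m => reflection_add_apply hne x m⟩
      rcases h with rfl | rfl | rfl
      · exact ⟨Equiv.swap ⟨i, hi'⟩ ⟨j, hj'⟩, fun _ => 1, fun _ => Or.inl rfl, fun x m => by
          rw [one_mul]; exact reflection_sub_apply hne x m⟩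
      · exact h2
      · rw [reflection_neg]; exact h2
    · obtain ⟨i, rfl⟩ : ∃ k, i = k + 1 := ⟨i - 1, by omega⟩
      have h2 : ∃ (σ : Equiv.Perm (Fin n)) (ε : Fin n → ℝ), (∀ j, ε j = 1 ∨ ε j = -1) ∧
          ∀ x m, reflection ((2 : ℝ) • e n (i + 1)) x m = ε m * x (σ m) :=
        ⟨1, fun m => if m = ⟨i, hi'⟩ then -1 else 1, fun m => by
          beta_reduce; split_ifs <;> simp, fun x m => by
          rw [reflection_two_smul_apply ⟨i, hi'⟩ x m]; by_cases hm : m = ⟨i, hi'⟩ <;> simp [hm]⟩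
      rcases h with rfl | rfl
      · exact h2
      · rw [reflection_neg]; exact h2
  have hinv : ∀ α : V n, (reflection α)⁻¹ = reflection α := fun α => by
    ext x : 1
    rfl
  refine Subgroup.closure_induction'' (p := fun w _ => ∃ (σ : Equiv.Perm (Fin n)) (ε : Fin n → ℝ),
    (∀ j, ε j = 1 ∨ ε j = -1) ∧ ∀ x j, w x j = ε j * x (σ j)) ?_ ?_ ?_ ?_ hw
  · rintro _ ⟨α, hα, rfl⟩; exact key α hα
  · rintro _ ⟨α, hα, rfl⟩; rw [hinv]; exact key α hα
  · exact ⟨1, fun _ => 1, fun _ => Or.inl rfl, fun x j => by simp⟩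
  · rintro u v _ _ ⟨σ, ε, hε, hu⟩ ⟨τ, η, hη, hv⟩
    refine ⟨σ.trans τ, fun j => ε j * η (σ j), fun j => ?_, fun x j => ?_⟩
    · rcases hε j with h | h <;> rcases hη (σ j) with h' | h' <;> simp [h, h']
    · rw [LinearEquiv.mul_apply, hu, hv, Equiv.trans_apply, mul_assoc]

theorem weylGroup_dotProduct {n : ℕ} {w : V n ≃ₗ[ℝ] V n} (hw : w ∈ weylGroup n) (x y : V n) :
    dotProduct (w x) (w y) = dotProduct x y := by
  obtain ⟨σ, ε, hε, h⟩ := weylGroup_signedPerm hw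
  simp only [dotProduct, h]
  rw [← Equiv.sum_comp σ (fun j => x j * y j)]
  refine Finset.sum_congr rfl fun j _ => ?_
  rcases hε j with h' | h' <;> rw [h'] <;> ring

/-! ### Affine simple roots and simple reflections in coordinates -/

/-- The value at `x` of the affine function `α + k δ`. -/
def evalAffine {n : ℕ} (f : V n × ℝ) (x : V n) : ℝ := dotProduct f.1 x + f.2

/-- Since `W_0` acts orthogonally, `act` is indeed `f ↦ f ∘ g⁻¹`. -/
theorem evalAffine_act {n : ℕ} (g : ExtAffineWeyl n) (f : V n × ℝ) (x : V n) :
    evalAffine (act g f) (aff g x) = evalAffine f x := by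
  simp only [evalAffine, act, aff, dotProduct_add, weylGroup_dotProduct g.right.2]
  ring

theorem evalAffine_injective {n : ℕ} {f f' : V n × ℝ}
    (h : ∀ x, evalAffine f x = evalAffine f' x) : f = f' := by
  have h0 := h 0
  simp only [evalAffine, dotProduct_zero, zero_add] at h0
  refine Prod.ext (dotProduct_eq _ _ fun x => ?_) h0
  have hx := h x
  simp only [evalAffine, h0] at hx
  exact add_right_cancel hx

theorem evalAffine_affineSimpleRoot_zero {n : ℕ} (hn : 1 ≤ n) (x : V n) :
    evalAffine (affineSimpleRoot 0) x = 1 - 2 * x ⟨0, hn⟩ := by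
  simp only [evalAffine, affineSimpleRoot, Fin.val_zero, if_true, highestRoot, neg_dotProduct,
    smul_dotProduct, smul_eq_mul, e_dotProduct le_rfl hn]
  ring

theorem evalAffine_affineSimpleRoot_of_lt {n k : ℕ} (hk : k + 1 < n) (x : V n) :
    evalAffine (affineSimpleRoot ⟨k + 1, by omega⟩) x = x ⟨k, by omega⟩ - x ⟨k + 1, hk⟩ := by
  have h := e_val_dotProduct (⟨k, by omega⟩ : Fin n) x
  have h' := e_val_dotProduct (⟨k + 1, hk⟩ : Fin n) x
  simp only at h h'
  simp [evalAffine, affineSimpleRoot, simpleRoot, hk, sub_dotProduct, h, h']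

theorem evalAffine_affineSimpleRoot_last {n : ℕ} (hn : 1 ≤ n) (x : V n) :
    evalAffine (affineSimpleRoot (Fin.last n)) x = 2 * x ⟨n - 1, by omega⟩ := by
  have : n ≠ 0 := by omega
  simp [evalAffine, affineSimpleRoot, simpleRoot, this, smul_dotProduct, e_dotProduct hn le_rfl]

theorem eq_of_evalAffine_affineSimpleRoot {n : ℕ} {x y : V n}
    (h : ∀ k, evalAffine (affineSimpleRoot k) x = evalAffine (affineSimpleRoot k) y) : x = y := by
  -- The system is triangular: `α_n` gives the last coordinate, and `α_{n-1}, …, α_1` then give the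
  -- others in descending order.
  have key : ∀ d (hd : d < n), x ⟨n - 1 - d, by omega⟩ = y ⟨n - 1 - d, by omega⟩ := by
    intro d
    induction d with
    | zero =>
      intro hd
      have := h (Fin.last n)
      rw [evalAffine_affineSimpleRoot_last hd, evalAffine_affineSimpleRoot_last hd] at this
      simpa using this
    | succ d ih =>
      intro hd
      have h1 := ih (by omega)
      have hk : n - 1 - (d + 1) + 1 < n := by omega
      have := h ⟨n - 1 - (d + 1) + 1, by omega⟩
      rw [evalAffine_affineSimpleRoot_of_lt hk, evalAffine_affineSimpleRoot_of_lt hk] at this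
      have e1 : n - 1 - (d + 1) + 1 = n - 1 - d := by omega
      simp only [e1] at this
      linarith
  funext j
  have := key (n - 1 - j) (by omega)
  have e1 : n - 1 - (n - 1 - j.val) = j := by omega
  simpa only [e1, Fin.eta] using this

theorem aff_s_zero {n : ℕ} (hn : 1 ≤ n) (x : V n) (m : Fin n) :
    aff (s 0) x m = if m.val = 0 then 1 - x m else x m := by
  have h := reflection_two_smul_apply (⟨0, hn⟩ : Fin n) x m
  have h2 := e_dotProduct le_rfl hn (e n 1)
  simp only [zero_add] at h
  rw [s, dif_pos hn, dif_pos (Fin.val_zero _)]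
  change reflection (highestRoot n) x m + (coroot (highestRoot n) + 0) m = _
  rw [add_zero, highestRoot, h, coroot]
  simp only [smul_dotProduct, dotProduct_smul, h2, Pi.smul_apply, smul_eq_mul, e, Fin.ext_iff,
    Nat.add_eq_right]
  split_ifs
  · simp; ring
  · simp

theorem aff_s_of_pos {n : ℕ} (i : Fin (n + 1)) (hi : i.val ≠ 0) (x : V n) :
    aff (s i) x = reflection (simpleRoot n i.val) x := by
  have hn : 1 ≤ n := by omega
  simp only [aff, s, hn, hi, dif_pos, dif_neg, not_false_eq_true]
  exact add_zero _

theorem aff_s_of_lt {n k : ℕ} (hk : k + 1 < n) (x : V n) (m : Fin n) :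
    aff (s ⟨k + 1, by omega⟩) x m = x (Equiv.swap ⟨k, by omega⟩ ⟨k + 1, hk⟩ m) := by
  rw [aff_s_of_pos _ (by simp), simpleRoot, if_pos hk]
  exact reflection_sub_apply (i := ⟨k, by omega⟩) (j := ⟨k + 1, hk⟩) (by simp) x m

theorem aff_s_last {n : ℕ} (hn : 1 ≤ n) (x : V n) (m : Fin n) :
    aff (s (Fin.last n)) x m = if m.val + 1 = n then -x m else x m := by
  obtain ⟨n, rfl⟩ : ∃ k, n = k + 1 := ⟨n - 1, by omega⟩
  rw [aff_s_of_pos _ (by simp), simpleRoot, if_neg (by simp)]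
  have := reflection_two_smul_apply (Fin.last n) x m
  simp only [Fin.val_last] at this
  simp only [this, Fin.ext_iff, Fin.val_last, Nat.add_right_cancel_iff]

/-! ### Positive roots, labelled by ordered pairs -/

/-- The linear functional `(α, ·)` of the positive root `α` labelled by `(a, b)`: this is
`e_a - e_b` if `a < b`, and `e_a + e_b` otherwise. -/
def pairing {n : ℕ} (a b : Fin n) (x : V n) : ℝ := if a < b then x a - x b else x a + x b

theorem pairing_add {n : ℕ} (a b : Fin n) (x y : V n) :
    pairing a b (x + y) = pairing a b x + pairing a b y := by
  simp only [pairing, Pi.add_apply]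
  split_ifs <;> ring

theorem pairing_int {n : ℕ} (a b : Fin n) {p : V n} (hp : p ∈ coweightLattice n) :
    ∃ m : ℤ, pairing a b p = m := by
  unfold pairing
  rcases lt_trichotomy a b with h | h | h
  · rw [if_pos h, ← e_val_dotProduct a p, ← e_val_dotProduct b p, ← sub_dotProduct]
    exact hp _ (Or.inl ⟨a + 1, b + 1, by omega, by omega, by omega, by omega, by omega, Or.inl rfl⟩)
  · subst h
    rw [if_neg (lt_irrefl a), ← two_mul, ← e_val_dotProduct a p, ← smul_eq_mul, ← smul_dotProduct]
    exact hp _ (Or.inr ⟨a + 1, by omega, by omega, Or.inl rfl⟩)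
  · rw [if_neg h.not_gt, ← e_val_dotProduct a p, ← e_val_dotProduct b p, ← add_dotProduct]
    exact hp _ (Or.inl ⟨a + 1, b + 1, by omega, by omega, by omega, by omega, by omega,
      Or.inr (Or.inl rfl)⟩)

/-- Distinct positive roots are not proportional. -/
theorem pairing_inj {n : ℕ} {a b c d : Fin n} {η : ℝ} (hη : η = 1 ∨ η = -1)
    (h : ∀ x, pairing a b x = η * pairing c d x) : (a, b) = (c, d) := by
  have ha := h (Pi.single a 1)
  have hb := h (Pi.single b 1)
  have hc := h (Pi.single c 1)
  have hd := h (Pi.single d 1)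
  simp only [pairing, Pi.single_apply] at ha hb hc hd
  rcases hη with rfl | rfl <;> grind

/-- A signed permutation permutes the roots, hence permutes the positive roots up to sign. -/
theorem pairing_weylGroup {n : ℕ} {w : V n ≃ₗ[ℝ] V n} (hw : w ∈ weylGroup n) (a b : Fin n) :
    ∃ (c d : Fin n) (η : ℝ), (η = 1 ∨ η = -1) ∧ ∀ x, pairing a b (w x) = η * pairing c d x := by
  obtain ⟨σ, ε, hε, h⟩ := weylGroup_signedPerm hw
  obtain ⟨μ, hμ, hμ'⟩ : ∃ μ : ℝ, (μ = 1 ∨ μ = -1) ∧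
      ∀ x, pairing a b (w x) = ε a * x (σ a) + μ * x (σ b) := by
    by_cases hab : a < b
    · refine ⟨-ε b, ?_, fun x => ?_⟩
      · rcases hε b with h' | h' <;> simp [h']
      · rw [pairing, if_pos hab, h, h]; ring
    · exact ⟨ε b, hε b, fun x => by rw [pairing, if_neg hab, h, h]⟩
  by_cases hab : a = b
  · subst hab
    refine ⟨σ a, σ a, ε a, hε a, fun x => ?_⟩
    rw [pairing, pairing, if_neg (lt_irrefl _), if_neg (lt_irrefl _), h]
    ring
  · have hσ : σ a ≠ σ b := fun h => hab (σ.injective h)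
    simp only [hμ']
    -- A difference is labelled with the smaller index first and a sum with the larger first, so the
    -- label and the sign `η` depend on the order of `σ a`, `σ b` and on both signs.
    rcases hσ.lt_or_gt with hlt | hlt <;> rcases hε a with h1 | h1 <;> rcases hμ with h2 | h2 <;>
      rw [h1, h2]
    · exact ⟨σ b, σ a, 1, by simp, fun x => by rw [pairing, if_neg hlt.not_gt]; ring⟩
    · exact ⟨σ a, σ b, 1, by simp, fun x => by rw [pairing, if_pos hlt]; ring⟩
    · exact ⟨σ a, σ b, -1, by simp, fun x => by rw [pairing, if_pos hlt]; ring⟩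
    · exact ⟨σ b, σ a, -1, by simp, fun x => by rw [pairing, if_neg hlt.not_gt]; ring⟩
    · exact ⟨σ a, σ b, 1, by simp, fun x => by rw [pairing, if_neg hlt.not_gt]; ring⟩
    · exact ⟨σ b, σ a, -1, by simp, fun x => by rw [pairing, if_pos hlt]; ring⟩
    · exact ⟨σ b, σ a, 1, by simp, fun x => by rw [pairing, if_pos hlt]; ring⟩
    · exact ⟨σ a, σ b, -1, by simp, fun x => by rw [pairing, if_neg hlt.not_gt]; ring⟩

/-! ### The base point of the fundamental alcove -/

/-- The point `ρ^∨ / h` of the fundamental alcove, where `h = 2 n` is the Coxeter number. -/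
noncomputable def alcovePoint (n : ℕ) : V n := fun j => (2 * n - 1 - 2 * j.val) / (4 * n)

theorem evalAffine_alcovePoint {n : ℕ} (hn : 1 ≤ n) (k : Fin (n + 1)) :
    evalAffine (affineSimpleRoot k) (alcovePoint n) = 1 / (2 * n) := by
  have h0 : (n : ℝ) ≠ 0 := by positivity
  obtain ⟨k, hk⟩ := k
  rcases Nat.eq_zero_or_pos k with rfl | hk0
  · change evalAffine (affineSimpleRoot 0) _ = _
    rw [evalAffine_affineSimpleRoot_zero hn]
    simp only [alcovePoint]
    field_simp
    push_cast
    ring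
  · obtain ⟨k, rfl⟩ : ∃ m, k = m + 1 := ⟨k - 1, by omega⟩
    by_cases hkn : k + 1 < n
    · rw [evalAffine_affineSimpleRoot_of_lt hkn]
      simp only [alcovePoint]
      field_simp
      push_cast
      ring
    · obtain rfl : n = k + 1 := by omega
      change evalAffine (affineSimpleRoot (Fin.last _)) _ = _
      rw [evalAffine_affineSimpleRoot_last hn]
      simp only [alcovePoint, Nat.add_sub_cancel]
      field_simp
      push_cast
      ring

/-- All affine simple roots take the same value `1 / h` at this point, so permuting them does not
move it. -/
theorem aff_alcovePoint_of_mem_Lam {n : ℕ} (hn : 1 ≤ n) {g : ExtAffineWeyl n} (hg : g ∈ Lam n) :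
    aff g (alcovePoint n) = alcovePoint n := by
  refine eq_of_evalAffine_affineSimpleRoot fun k => ?_
  have hk : affineSimpleRoot k ∈ act g '' Set.range affineSimpleRoot := by
    rw [show act g '' Set.range affineSimpleRoot = Set.range affineSimpleRoot from hg]
    exact ⟨k, rfl⟩
  obtain ⟨_, ⟨j, rfl⟩, hj⟩ := hk
  rw [← hj, evalAffine_act, hj, evalAffine_alcovePoint hn, evalAffine_alcovePoint hn]

/-- The value is the height of the root divided by `h`, and heights run from `1` to `h - 1`. -/
theorem pairing_alcovePoint {n : ℕ} (a b : Fin n) :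
    0 < pairing a b (alcovePoint n) ∧ pairing a b (alcovePoint n) < 1 := by
  obtain ⟨a, ha⟩ := a
  obtain ⟨b, hb⟩ := b
  have hn : (0 : ℝ) < 4 * n := by have : 0 < n := by omega
                                  positivity
  simp only [pairing, alcovePoint, Fin.mk_lt_mk]
  have ha' : (a : ℝ) + 1 ≤ n := by exact_mod_cast ha
  have hb' : (b : ℝ) + 1 ≤ n := by exact_mod_cast hb
  have ha0 : (0 : ℝ) ≤ a := by positivity
  have hb0 : (0 : ℝ) ≤ b := by positivity
  split_ifs with h
  · have : (a : ℝ) + 1 ≤ b := by exact_mod_cast h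
    rw [← sub_div, lt_div_iff₀ hn, div_lt_iff₀ hn]
    constructor <;> linarith
  · rw [← add_div, lt_div_iff₀ hn, div_lt_iff₀ hn]
    constructor <;> linarith

/-- A simple reflection moves `ρ^∨ / h` across the wall of exactly one positive root. -/
theorem pairing_aff_s {n : ℕ} (hn : 1 ≤ n) (i : Fin (n + 1)) :
    ∃ a₀ b₀ : Fin n, |pairing a₀ b₀ (aff (s i) (alcovePoint n)) -
        pairing a₀ b₀ (alcovePoint n)| ≤ 1 ∧
      ∀ a b : Fin n, (a, b) ≠ (a₀, b₀) → 0 < pairing a b (aff (s i) (alcovePoint n)) ∧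
        pairing a b (aff (s i) (alcovePoint n)) < 1 := by
  have hn4 : (0 : ℝ) < 4 * n := by positivity
  have hn1 : (1 : ℝ) ≤ n := by exact_mod_cast hn
  -- It suffices to compute with the coordinates multiplied by `4 n`, which are integers.
  have key : ∀ (Y : Fin n → ℤ) (a₀ b₀ : Fin n),
      (∀ m, aff (s i) (alcovePoint n) m = Y m / (4 * n)) →
      (|(if a₀ < b₀ then Y a₀ - Y b₀ else Y a₀ + Y b₀) -
        (if a₀ < b₀ then (2 * (b₀.val : ℤ) - 2 * a₀.val) else
          4 * n - 2 - 2 * a₀.val - 2 * b₀.val)| ≤ 4 * n) →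
      (∀ a b : Fin n, (a, b) ≠ (a₀, b₀) → 0 < (if a < b then Y a - Y b else Y a + Y b) ∧
        (if a < b then Y a - Y b else Y a + Y b) < 4 * n) →
      ∃ a₀ b₀ : Fin n, |pairing a₀ b₀ (aff (s i) (alcovePoint n)) -
        pairing a₀ b₀ (alcovePoint n)| ≤ 1 ∧
      ∀ a b : Fin n, (a, b) ≠ (a₀, b₀) → 0 < pairing a b (aff (s i) (alcovePoint n)) ∧
        pairing a b (aff (s i) (alcovePoint n)) < 1 := by
    intro Y a₀ b₀ hY h1 h2
    have hp : ∀ a b, pairing a b (aff (s i) (alcovePoint n)) =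
        ((if a < b then Y a - Y b else Y a + Y b : ℤ) : ℝ) / (4 * n) := by
      intro a b
      simp only [pairing, hY]
      split_ifs <;> push_cast <;> ring
    have hq : ∀ a b, pairing a b (alcovePoint n) =
        ((if a < b then (2 * (b.val : ℤ) - 2 * a.val) else
          4 * n - 2 - 2 * a.val - 2 * b.val : ℤ) : ℝ) / (4 * n) := by
      intro a b
      simp only [pairing, alcovePoint]
      split_ifs <;> push_cast <;> ring
    refine ⟨a₀, b₀, ?_, fun a b hab => ?_⟩
    · rw [hp, hq, ← sub_div, abs_div, abs_of_pos hn4, div_le_one hn4]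
      exact_mod_cast h1
    · rw [hp, lt_div_iff₀ hn4, div_lt_iff₀ hn4, zero_mul, one_mul]
      exact_mod_cast h2 a b hab
  obtain ⟨k, hk⟩ := i
  rcases Nat.eq_zero_or_pos k with rfl | hk0
  -- `s_0` turns the first scaled coordinate `2n - 1` into `4n - (2n - 1)`; the root involved is `θ
  -- = 2 e_1`, with label `(0, 0)`.
  · refine key (fun m => if m.val = 0 then 2 * n + 1 else 2 * n - 1 - 2 * m.val)
      ⟨0, hn⟩ ⟨0, hn⟩ (fun m => ?_) ?_ ?_
    · refine (aff_s_zero hn _ m).trans ?_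
      simp only [alcovePoint]
      split_ifs with h
      · rw [h]; field_simp; push_cast; ring
      · push_cast; rfl
    · simp only [lt_irrefl, if_true, if_false, abs_le]
      omega
    · rintro ⟨a, ha⟩ ⟨b, hb⟩ hab
      simp only [ne_eq, Prod.mk.injEq, Fin.mk.injEq, Fin.mk_lt_mk] at hab ⊢
      split_ifs <;> omega
  · obtain ⟨k, rfl⟩ : ∃ m, k = m + 1 := ⟨k - 1, by omega⟩
    by_cases hkn : k + 1 < n
    · refine key (fun m => if m.val = k then 2 * n - 1 - 2 * (k + 1) else
          if m.val = k + 1 then 2 * n - 1 - 2 * k else 2 * n - 1 - 2 * m.val)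
        ⟨k, by omega⟩ ⟨k + 1, hkn⟩ (fun m => ?_) ?_ ?_
      · rw [aff_s_of_lt hkn, Equiv.swap_apply_def]
        simp only [alcovePoint, Fin.ext_iff]
        split_ifs <;> push_cast <;> rfl
      · simp only [Fin.mk_lt_mk, lt_add_one, if_true, abs_le]
        push_cast
        split_ifs <;> omega
      · rintro ⟨a, ha⟩ ⟨b, hb⟩ hab
        simp only [ne_eq, Prod.mk.injEq, Fin.mk.injEq, Fin.mk_lt_mk] at hab ⊢
        split_ifs <;> omega
    · obtain rfl : n = k + 1 := by omega
      -- The last scaled coordinate is `1`, and `s_n` negates it; the root involved is `2 e_n`.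
      refine key (fun m => if m.val = k then -1 else 2 * (k + 1) - 1 - 2 * m.val)
        ⟨k, by omega⟩ ⟨k, by omega⟩ (fun m => ?_) ?_ ?_
      · refine (aff_s_last hn _ m).trans ?_
        simp only [alcovePoint, Nat.add_right_cancel_iff]
        split_ifs with h
        · rw [h]; push_cast; ring
        · push_cast; rfl
      · simp only [lt_irrefl, if_true, if_false, abs_le]
        push_cast
        omega
      · rintro ⟨a, ha⟩ ⟨b, hb⟩ hab
        simp only [ne_eq, Prod.mk.injEq, Fin.mk.injEq, Fin.mk_lt_mk] at hab ⊢
        push_cast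
        split_ifs <;> omega

/-! ### The lower bound for the length -/

/-- The signed number of hyperplanes between the fundamental alcove `A` and the alcove `g A`. -/
noncomputable def signedLength {n : ℕ} (g : ExtAffineWeyl n) : ℤ :=
  ∑ a : Fin n, ∑ b : Fin n, ⌊pairing a b (aff g (alcovePoint n))⌋

/-- Pulled back by `g`, each positive root becomes a positive root up to sign, plus an integer. Its
floor can change only if that root is the one whose wall `s_i` crosses, which happens for at most
one term, and there the value moves by at most `1`. -/
theorem signedLength_mul_s_le {n : ℕ} (hn : 1 ≤ n) (g : ExtAffineWeyl n) (i : Fin (n + 1)) :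
    signedLength (g * s i) ≤ signedLength g + 1 := by
  obtain ⟨a₀, b₀, h₀, hs⟩ := pairing_aff_s hn i
  have hw : ∀ q : Fin n × Fin n, ∃ (c : Fin n × Fin n) (η : ℝ), (η = 1 ∨ η = -1) ∧
      ∀ x, pairing q.1 q.2 (g.right.1 x) = η * pairing c.1 c.2 x := fun q => by
    obtain ⟨c, d, η, hη, h⟩ := pairing_weylGroup g.right.2 q.1 q.2
    exact ⟨(c, d), η, hη, h⟩
  choose c η hη hc using hw
  have hterm : ∀ q : Fin n × Fin n, ⌊pairing q.1 q.2 (aff (g * s i) (alcovePoint n))⌋ ≤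
      ⌊pairing q.1 q.2 (aff g (alcovePoint n))⌋ + if c q = (a₀, b₀) then 1 else 0 := by
    intro q
    obtain ⟨m, hm⟩ := pairing_int q.1 q.2 (Multiplicative.toAdd g.left).2
    have hg : ∀ x, pairing q.1 q.2 (aff g x) = η q * pairing (c q).1 (c q).2 x + m := fun x => by
      rw [aff, pairing_add, hc, hm]
    rw [aff_mul, hg, hg, Int.floor_add_intCast, Int.floor_add_intCast]
    split_ifs with h
    · rw [h]
      have h1 : η q * pairing a₀ b₀ (aff (s i) (alcovePoint n)) ≤
          η q * pairing a₀ b₀ (alcovePoint n) + 1 := by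
        rw [abs_le] at h₀
        rcases hη q with h' | h' <;> rw [h'] <;> linarith
      have := Int.floor_le_floor h1
      rw [Int.floor_add_one] at this
      linarith
    · have h1 := hs (c q).1 (c q).2 h
      have h2 := pairing_alcovePoint (c q).1 (c q).2
      refine le_of_eq ?_
      rw [add_zero, add_left_inj]
      rcases hη q with h' | h' <;> rw [h']
      · rw [one_mul, one_mul, Int.floor_eq_zero_iff.mpr ⟨h1.1.le, h1.2⟩,
          Int.floor_eq_zero_iff.mpr ⟨h2.1.le, h2.2⟩]
      -- For a negated root both values lie in `(-1, 0)`, so both floors are `-1`.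
      · have h3 : ∀ t : ℝ, 0 < t ∧ t < 1 → ⌊-1 * t⌋ = -1 := fun t ht =>
          Int.floor_eq_iff.mpr ⟨by push_cast; linarith, by push_cast; linarith⟩
        rw [h3 _ h1, h3 _ h2]
  have hone : ∑ q : Fin n × Fin n, (if c q = (a₀, b₀) then (1 : ℤ) else 0) ≤ 1 := by
    rw [Finset.sum_boole]
    norm_cast
    refine Finset.card_le_one.mpr fun q hq r hr => ?_
    have hq' := (Finset.mem_filter.mp hq).2
    have hr' := (Finset.mem_filter.mp hr).2
    -- Two positive roots with the same pullback up to sign are proportional, hence equal.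
    refine pairing_inj (η := η q * η r) ?_ fun x => ?_
    · rcases hη q with h | h <;> rcases hη r with h' | h' <;> simp [h, h']
    · have h1 := hc q (g.right.1.symm x)
      have h2 := hc r (g.right.1.symm x)
      rw [LinearEquiv.apply_symm_apply] at h1 h2
      rw [h1, h2, hq', hr']
      rcases hη r with h' | h' <;> rw [h'] <;> ring
  unfold signedLength
  rw [← Fintype.sum_prod_type', ← Fintype.sum_prod_type']
  calc _ ≤ ∑ q : Fin n × Fin n, (⌊pairing q.1 q.2 (aff g (alcovePoint n))⌋ +
        if c q = (a₀, b₀) then 1 else 0) := Finset.sum_le_sum fun q _ => hterm q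
    _ ≤ _ := by rw [Finset.sum_add_distrib]; linarith

theorem signedLength_mul_wordProd_le {n : ℕ} (hn : 1 ≤ n) (g : ExtAffineWeyl n)
    (L : List (Fin (n + 1))) : signedLength (g * wordProd L) ≤ signedLength g + L.length := by
  induction L generalizing g with
  | nil => simp [wordProd]
  | cons i L ih =>
    have h1 := ih (g * s i)
    have h2 := signedLength_mul_s_le hn g i
    have h3 : g * wordProd (i :: L) = g * s i * wordProd L := by
      simp [wordProd, mul_assoc]
    rw [h3, List.length_cons]
    push_cast
    linarith

theorem signedLength_of_mem_Lam {n : ℕ} (hn : 1 ≤ n) {g : ExtAffineWeyl n} (hg : g ∈ Lam n) :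
    signedLength g = 0 := by
  unfold signedLength
  rw [aff_alcovePoint_of_mem_Lam hn hg]
  refine Finset.sum_eq_zero fun a _ => Finset.sum_eq_zero fun b _ => ?_
  have h := pairing_alcovePoint a b
  exact Int.floor_eq_zero_iff.mpr ⟨h.1.le, h.2⟩

/-! ### The signed length of translations -/

/-- This is `2ρ = (2n, 2n - 2, …, 2)`: as first index `b` contributes `n`, and as second index `n -
2b`, one minus sign for each `a < b`. -/
theorem sum_pairing {n : ℕ} (x : V n) :
    ∑ a : Fin n, ∑ b : Fin n, pairing a b x = ∑ b : Fin n, (2 * n - 2 * b.val) * x b := by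
  have h1 : ∀ a b : Fin n, pairing a b x = x a + (1 - 2 * if a < b then 1 else 0) * x b := by
    intro a b
    unfold pairing
    split_ifs <;> ring
  have h2 : ∀ b : Fin n, (∑ a : Fin n, if a < b then (1 : ℝ) else 0) = b.val := by
    intro b
    rw [Finset.sum_boole, ← Fin.card_Iio b]
    congr 2
    ext a
    simp
  simp only [h1, Finset.sum_add_distrib]
  rw [Finset.sum_comm (f := fun a b : Fin n => (1 - 2 * if a < b then (1 : ℝ) else 0) * x b),
    ← Finset.sum_add_distrib]
  refine Finset.sum_congr rfl fun b _ => ?_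
  rw [← Finset.sum_mul, Finset.sum_sub_distrib, ← Finset.mul_sum, h2]
  simp only [Finset.sum_const, Finset.card_univ, Fintype.card_fin, nsmul_eq_mul, mul_one]
  ring

/-- Positive roots are integral on `p` and lie in `(0, 1)` at the base point, so each floor is
exactly the pairing with `p`. -/
theorem signedLength_translation {n : ℕ} (p : coweightLattice n) :
    (signedLength (translation p) : ℝ) = ∑ b : Fin n, (2 * n - 2 * b.val) * p.1 b := by
  rw [← sum_pairing, signedLength]
  push_cast
  refine Finset.sum_congr rfl fun a _ => Finset.sum_congr rfl fun b _ => ?_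
  obtain ⟨m, hm⟩ := pairing_int a b p.2
  have h : aff (translation p) (alcovePoint n) = alcovePoint n + p.1 := rfl
  have h' := pairing_alcovePoint a b
  rw [h, pairing_add, hm, Int.floor_add_intCast, Int.floor_eq_zero_iff.mpr ⟨h'.1.le, h'.2⟩, zero_add]

theorem signedLength_ω {n i : ℕ} (hi : i < n) :
    signedLength (ω i : ExtAffineWeyl n) = i * (2 * n + 1 - i) := by
  have h := signedLength_translation (⟨_, fundamentalCoweightVec_mem n i⟩ : coweightLattice n)
  -- Partial sums, with `n` fixed in the summand so that induction on `N` applies.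
  have h2 : ∀ N : ℕ, ∑ b ∈ Finset.range N, ((2 * n - 2 * b) * (if b < i then 1 else 0) : ℝ) =
      (min N i : ℕ) * (2 * n + 1 - (min N i : ℕ)) := by
    intro N
    induction N with
    | zero => simp
    | succ N ih =>
      rw [Finset.sum_range_succ, ih]
      split_ifs with hN
      · rw [min_eq_left hN.le, min_eq_left (Nat.succ_le_of_lt hN)]
        push_cast
        ring
      · rw [min_eq_right (by omega), min_eq_right (by omega)]
        ring
  simp only [fundamentalCoweightVec_apply_of_lt hi] at h
  rw [Fin.sum_univ_eq_sum_range (fun b => ((2 * n - 2 * b) * (if b < i then 1 else 0) : ℝ)), h2,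
    min_eq_right hi.le] at h
  exact_mod_cast h

theorem two_mul_signedLength_ω_self {n : ℕ} :
    2 * signedLength (ω n : ExtAffineWeyl n) = n * (n + 1) := by
  have h := signedLength_translation (⟨_, fundamentalCoweightVec_mem n n⟩ : coweightLattice n)
  have h2 : ∀ N : ℕ, ∑ b ∈ Finset.range N, ((2 * n - 2 * b) * (1 / 2) : ℝ) =
      N * (2 * n + 1 - N) / 2 := by
    intro N
    induction N with
    | zero => simp
    | succ N ih =>
      rw [Finset.sum_range_succ, ih]
      push_cast
      ring
  simp only [fundamentalCoweightVec_self_apply] at h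
  rw [Fin.sum_univ_eq_sum_range (fun b => ((2 * n - 2 * b) * (1 / 2) : ℝ)), h2] at h
  have h3 : (2 * signedLength (ω n : ExtAffineWeyl n) : ℝ) = n * (n + 1) := by
    change 2 * (signedLength (translation _) : ℝ) = _
    rw [h]
    ring
  exact_mod_cast h3

theorem isReducedExpression_of_length_le {n : ℕ} (hn : 1 ≤ n) {g lam : ExtAffineWeyl n}
    {L : List (Fin (n + 1))} (hlam : lam ∈ Lam n) (hg : g = lam * wordProd L)
    (hL : (L.length : ℤ) ≤ signedLength g) : IsReducedExpression g lam L := by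
  refine ⟨hlam, hg, fun lam' hlam' L' hg' => ?_⟩
  have h := signedLength_mul_wordProd_le hn lam' L'
  rw [← hg', signedLength_of_mem_Lam hn hlam', zero_add] at h
  exact_mod_cast hL.trans h

/-! ### The words as maps of coordinates -/

theorem fin_ofNat_eq {n k : ℕ} (hk : k ≤ n) : Fin.ofNat (n + 1) k = ⟨k, by omega⟩ :=
  Fin.ext (Nat.mod_eq_of_lt (by omega))

theorem seg_eq_cons {n k l : ℕ} (hkl : k ≤ l) :
    seg n k l = Fin.ofNat (n + 1) k :: seg n (k + 1) l := by
  rw [seg, seg, show l + 1 - k = (l + 1 - (k + 1)) + 1 by omega, List.range'_succ, List.map_cons]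

theorem seg_eq_nil (n k : ℕ) : seg n (k + 1) k = [] := by
  simp [seg]

theorem seg_eq_append {n k : ℕ} (hk : 1 ≤ k) (hkn : k ≤ n) :
    seg n k n = seg n k (n - 1) ++ [Fin.last n] := by
  rw [seg, seg, show n + 1 - k = (n - 1 + 1 - k) + 1 by omega, List.range'_concat, List.map_append,
    List.map_singleton, show k + 1 * (n - 1 + 1 - k) = n by omega, fin_ofNat_eq le_rfl]
  rfl

theorem length_seg (n k l : ℕ) : (seg n k l).length = l + 1 - k := by
  simp [seg]

/-- Writing points as restrictions of functions on `ℕ` keeps bounds proofs out of the index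
arithmetic when maps are composed. -/
theorem aff_s_of_lt_val {n k : ℕ} (hk : 1 ≤ k) (hkn : k < n) (X : ℕ → ℝ) :
    aff (s (Fin.ofNat (n + 1) k)) (fun j : Fin n => X j) =
      fun j : Fin n => if j.val + 1 = k then X k else if j.val = k then X (k - 1) else X j := by
  obtain ⟨k, rfl⟩ : ∃ m, k = m + 1 := ⟨k - 1, by omega⟩
  funext j
  rw [fin_ofNat_eq hkn.le, aff_s_of_lt hkn, Equiv.swap_apply_def]
  simp only [Fin.ext_iff, Nat.add_right_cancel_iff]
  split_ifs <;> rfl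

theorem aff_s_last_val {n : ℕ} (hn : 1 ≤ n) (X : ℕ → ℝ) :
    aff (s (Fin.last n)) (fun j : Fin n => X j) =
      fun j : Fin n => if j.val + 1 = n then -X j else X j :=
  funext fun j => aff_s_last hn _ j

theorem aff_s_zero_val {n : ℕ} (hn : 1 ≤ n) (X : ℕ → ℝ) :
    aff (s 0) (fun j : Fin n => X j) =
      fun j : Fin n => if j.val = 0 then 1 - X j else X j :=
  funext fun j => aff_s_zero hn _ j

/-- The entry in position `l + 1` moves to position `k`, pushing those between one step right. The
empty segment `k = l + 1` starts the downward induction on `k`. -/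
theorem aff_seg_of_lt {n k l : ℕ} (hk : 1 ≤ k) (hkl : k ≤ l + 1) (hl : l < n) (X : ℕ → ℝ) :
    aff (wordProd (seg n k l)) (fun j : Fin n => X j) =
      fun j : Fin n => if j.val + 1 = k then X l else
        if k ≤ j.val ∧ j.val ≤ l then X (j - 1) else X j := by
  induction hkl using Nat.decreasingInduction with
  | self =>
    rw [seg_eq_nil, aff_wordProd_nil]
    funext j
    split_ifs with h1 h2
    · rw [Nat.add_right_cancel_iff.mp h1]
    · omega
    · rfl
  | of_succ k hkl ih =>
    rw [seg_eq_cons (by omega), aff_wordProd_cons, ih (by omega),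
      aff_s_of_lt_val hk (by omega) (fun j => if j + 1 = k + 1 then X l else
        if k + 1 ≤ j ∧ j ≤ l then X (j - 1) else X j)]
    funext j
    grind

theorem aff_seg_last {n k : ℕ} (hk : 1 ≤ k) (hkn : k ≤ n) (X : ℕ → ℝ) :
    aff (wordProd (seg n k n)) (fun j : Fin n => X j) =
      fun j : Fin n => if j.val + 1 = k then -X (n - 1) else
        if k ≤ j.val then X (j - 1) else X j := by
  rw [seg_eq_append hk hkn, aff_wordProd_append, aff_wordProd_cons, aff_wordProd_nil,
    aff_s_last_val (by omega), aff_seg_of_lt hk (by omega) (by omega)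
      (fun j => if j + 1 = n then -X j else X j)]
  funext j
  have := j.isLt
  grind

theorem flatMap_range_sub_succ {α : Type*} (N : ℕ) (f : ℕ → List α) :
    ((List.range (N + 1)).flatMap fun j => f (N + 1 - j)) =
      f (N + 1) ++ (List.range N).flatMap fun j => f (N - j) := by
  rw [List.range_succ_eq_map, List.flatMap_cons, List.flatMap_map]
  simp

/-- The factors act from the right: each `[r,n]` takes the current last entry, negates it and
inserts it at position `r`. -/
theorem aff_flatMap_seg_last {n N : ℕ} (hN : N ≤ n) (X : ℕ → ℝ) :
    aff (wordProd ((List.range N).flatMap fun j => seg n (N - j) n)) (fun j : Fin n => X j) =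
      fun j : Fin n => if j.val < N then -X (n - 1 - j) else X (j - N) := by
  induction N with
  | zero => simp [aff_wordProd_nil]
  | succ N ih =>
    rw [flatMap_range_sub_succ N (fun r => seg n r n), aff_wordProd_append, ih (by omega),
      aff_seg_last (by omega) hN (fun j => if j < N then -X (n - 1 - j) else X (j - N))]
    funext j
    have := j.isLt
    grind

/-- Each factor `[r,r+i-1]` moves the block of the original first `i` entries one step right; after
`N` factors it has passed the next `N` entries. -/
theorem aff_flatMap_seg_mid {n i N : ℕ} (hi : 1 ≤ i) (hN : N + i ≤ n) (X : ℕ → ℝ) :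
    aff (wordProd ((List.range N).flatMap fun j => seg n (N - j) (N - j + i - 1)))
        (fun j : Fin n => X j) =
      fun j : Fin n => if j.val < N then X (j + i) else if j.val < N + i then X (j - N) else X j := by
  induction N with
  | zero =>
    rw [List.range_zero, List.flatMap_nil, aff_wordProd_nil]
    funext j
    simp
  | succ N ih =>
    rw [flatMap_range_sub_succ N (fun r => seg n r (r + i - 1)), aff_wordProd_append,
      ih (by omega), aff_seg_of_lt (by omega) (by omega) (by omega) (fun j => if j < N then X (j + i)
        else if j < N + i then X (j - N) else X j)]
    funext j
    have := j.isLt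
    grind

theorem aff_zero_cons_seg {n : ℕ} (hn : 1 ≤ n) (X : ℕ → ℝ) :
    aff (wordProd (0 :: seg n 1 n)) (fun j : Fin n => X j) =
      fun j : Fin n => if j.val = 0 then X (n - 1) + 1 else X (j - 1) := by
  rw [aff_wordProd_cons, aff_seg_last le_rfl hn, aff_s_zero_val hn (fun j => if j + 1 = 1 then
    -X (n - 1) else if 1 ≤ j then X (j - 1) else X j)]
  funext j
  grind

theorem aff_flatten_replicate {n i : ℕ} (hi : i ≤ n) (X : ℕ → ℝ) :
    aff (wordProd (List.replicate i (0 :: seg n 1 n)).flatten) (fun j : Fin n => X j) =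
      fun j : Fin n => if j.val < i then X (n - i + j) + 1 else X (j - i) := by
  induction i with
  | zero => simp [aff_wordProd_nil]
  | succ i ih =>
    rw [List.replicate_succ, List.flatten_cons, aff_wordProd_append, ih (by omega),
      aff_zero_cons_seg (by omega) (fun j => if j < i then X (n - i + j) + 1 else X (j - i))]
    funext j
    have := j.isLt
    grind

theorem exists_eq_val {n : ℕ} (x : V n) : ∃ X : ℕ → ℝ, x = fun j : Fin n => X j :=
  ⟨fun j => if h : j < n then x ⟨j, h⟩ else 0, funext fun j => by simp⟩

theorem aff_wordTop {n : ℕ} (x : V n) (j : Fin n) :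
    aff (wordProd (wordTop n)) x j = -x j.rev := by
  obtain ⟨X, rfl⟩ := exists_eq_val x
  rw [wordTop, aff_flatMap_seg_last le_rfl]
  simp only [j.isLt, if_true, Fin.val_rev]
  congr 2
  omega

theorem wordMid_eq {n i : ℕ} (hi : i < n) :
    wordMid n i = (List.replicate i (0 :: seg n 1 n)).flatten ++
      (List.range (n - i)).flatMap fun j => seg n (n - i - j) (n - i - j + i - 1) := by
  rw [wordMid]
  congr 1
  refine List.flatMap_congr fun j hj => ?_
  rw [List.mem_range] at hj
  congr 1
  omega

theorem ω_eq_wordProd_wordMid {n i : ℕ} (hi : 1 ≤ i) (hin : i < n) :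
    ω i = wordProd (n := n) (wordMid n i) := by
  refine aff_injective fun x => ?_
  obtain ⟨X, rfl⟩ := exists_eq_val x
  -- The block exchange and the `i`-fold rotation are inverse permutations; only the `1` added to
  -- each wrapped entry survives.
  rw [wordMid_eq hin, aff_wordProd_append, aff_flatMap_seg_mid hi (by omega),
    aff_flatten_replicate hin.le (fun j => if j < n - i then X (j + i) else
      if j < n - i + i then X (j - (n - i)) else X j), aff_ω]
  funext j
  rw [Pi.add_apply, fundamentalCoweightVec_apply_of_lt hin]
  have := j.isLt
  grind

/-! ### Lengths of the words -/

theorem length_wordMid {n i : ℕ} (hin : i < n) :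
    ((wordMid n i).length : ℤ) = i * (2 * n + 1 - i) := by
  have h : (wordMid n i).length = i * (n + 1) + (n - i) * i := by
    rw [wordMid_eq hin, List.length_append, List.length_flatten, List.map_replicate,
      List.sum_replicate, List.length_cons, length_seg, List.length_flatMap,
      List.map_congr_left (g := fun _ => i)]
    · simp
    · intro j hj
      rw [List.mem_range] at hj
      rw [length_seg]
      omega
  rw [h]
  push_cast [hin.le]
  ring

theorem two_mul_length_wordTop (n : ℕ) : 2 * (wordTop n).length = n * (n + 1) := by
  have h : ∀ N ≤ n, 2 * ((List.range N).flatMap fun j => seg n (n - j) n).length = N * (N + 1) := by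
    intro N hN
    induction N with
    | zero => simp
    | succ N ih =>
      rw [List.range_succ, List.flatMap_append, List.length_append, mul_add, ih (by omega),
        List.flatMap_singleton, length_seg, show n + 1 - (n - N) = N + 1 by omega]
      ring
  exact h n le_rfl

/-! ### The element `π_n` and the group `Λ` -/

/-- The affine simple roots separate points, so their images determine the inverse map; this gives
the uniqueness of `π_n`. -/
theorem act_injective {n : ℕ} {g h : ExtAffineWeyl n}
    (H : ∀ k, act g (affineSimpleRoot k) = act h (affineSimpleRoot k)) : g = h := by
  refine inv_injective (aff_injective fun x => eq_of_evalAffine_affineSimpleRoot fun k => ?_)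
  rw [← evalAffine_act g _ (aff g⁻¹ x), ← evalAffine_act h _ (aff h⁻¹ x), aff_aff_inv, aff_aff_inv, H]

theorem aff_ω_mul_wordTop_inv {n : ℕ} (x : V n) (j : Fin n) :
    aff (ω n * (wordProd (wordTop n))⁻¹) x j = 1 / 2 - x j.rev := by
  have h : aff (wordProd (wordTop n))⁻¹ x = fun j => -x j.rev := by
    have h1 : aff (wordProd (wordTop n)) (fun j => -x j.rev) = x := by
      funext j
      rw [aff_wordTop, Fin.rev_rev, neg_neg]
    rw [← h1, aff_inv_aff, h1]
  rw [aff_mul, h, aff_ω, Pi.add_apply, fundamentalCoweightVec_self_apply]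
  ring

theorem isPi_ω_mul_wordTop_inv {n : ℕ} (hn : 1 ≤ n) :
    IsPi (ω n * (wordProd (wordTop n))⁻¹ : ExtAffineWeyl n) := by
  intro k
  refine evalAffine_injective fun x => ?_
  -- Every point is the image of some `y`, and there the left side is just the value of `α_k` at
  -- `y`.
  rw [← aff_aff_inv (ω n * (wordProd (wordTop n))⁻¹) x, evalAffine_act]
  generalize aff (ω n * (wordProd (wordTop n))⁻¹)⁻¹ x = y
  obtain ⟨k, hk⟩ := k
  rcases Nat.eq_zero_or_pos k with rfl | hk0
  · rw [show Fin.rev (⟨0, hk⟩ : Fin (n + 1)) = Fin.last n from Fin.rev_zero n,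
      evalAffine_affineSimpleRoot_last hn, aff_ω_mul_wordTop_inv]
    refine (evalAffine_affineSimpleRoot_zero hn y).trans ?_
    rw [show Fin.rev (⟨n - 1, by omega⟩ : Fin n) = ⟨0, hn⟩ from Fin.ext (by simp; omega)]
    ring
  · obtain ⟨k, rfl⟩ : ∃ m, k = m + 1 := ⟨k - 1, by omega⟩
    by_cases hkn : k + 1 < n
    · have h1 : n - 2 - k + 1 < n := by omega
      rw [show Fin.rev (⟨k + 1, hk⟩ : Fin (n + 1)) = ⟨n - 2 - k + 1, by omega⟩ from
          Fin.ext (by simp; omega),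
        evalAffine_affineSimpleRoot_of_lt hkn, evalAffine_affineSimpleRoot_of_lt h1,
        aff_ω_mul_wordTop_inv, aff_ω_mul_wordTop_inv,
        show Fin.rev (⟨n - 2 - k, by omega⟩ : Fin n) = ⟨k + 1, hkn⟩ from Fin.ext (by simp; omega),
        show Fin.rev (⟨n - 2 - k + 1, h1⟩ : Fin n) = ⟨k, by omega⟩ from Fin.ext (by simp; omega)]
      ring
    · obtain rfl : n = k + 1 := by omega
      rw [show Fin.rev (⟨k + 1, hk⟩ : Fin (k + 1 + 1)) = 0 from Fin.rev_last _,
        evalAffine_affineSimpleRoot_zero hn, aff_ω_mul_wordTop_inv]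
      refine (evalAffine_affineSimpleRoot_last hn y).trans ?_
      rw [show Fin.rev (⟨0, hn⟩ : Fin (k + 1)) = ⟨k + 1 - 1, by omega⟩ from Fin.rev_zero k]
      ring

theorem IsPi.mem_Lam {n : ℕ} {g : ExtAffineWeyl n} (hg : IsPi g) : g ∈ Lam n := by
  change act g '' Set.range affineSimpleRoot = Set.range affineSimpleRoot
  rw [← Set.range_comp, show act g ∘ affineSimpleRoot = affineSimpleRoot ∘ Fin.rev from funext hg]
  exact Fin.rev_surjective.range_comp _

theorem one_mem_Lam (n : ℕ) : (1 : ExtAffineWeyl n) ∈ Lam n := by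
  have h : ∀ f : V n × ℝ, act 1 f = f := fun f => evalAffine_injective fun x => by
    have := evalAffine_act 1 f x
    rwa [aff_one] at this
  change act 1 '' _ = _
  rw [funext h, Set.image_id']

end TypeC

theorem mainTheorem7 (n : ℕ) (hn : 2 ≤ n) :
    ((∃! π : TypeC.ExtAffineWeyl n, TypeC.IsPi π) ∧
      ∀ π : TypeC.ExtAffineWeyl n, TypeC.IsPi π →
        TypeC.ω n = π * TypeC.wordProd (TypeC.wordTop n) ∧
        TypeC.IsReducedExpression (TypeC.ω n) π (TypeC.wordTop n)) ∧
    ∀ i : ℕ, 1 ≤ i → i < n →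
      TypeC.ω i = TypeC.wordProd (n := n) (TypeC.wordMid n i) ∧
      TypeC.IsReducedExpression (n := n) (TypeC.ω i) 1 (TypeC.wordMid n i) := by
  have hn1 : 1 ≤ n := by omega
  have hpi := TypeC.isPi_ω_mul_wordTop_inv hn1
  have huniq : ∀ π : TypeC.ExtAffineWeyl n, TypeC.IsPi π →
      π = TypeC.ω n * (TypeC.wordProd (TypeC.wordTop n))⁻¹ := fun π hπ =>
    TypeC.act_injective fun k => (hπ k).trans (hpi k).symm
  refine ⟨⟨⟨_, hpi, huniq⟩, fun π hπ => ?_⟩, fun i hi hin => ?_⟩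
  · have h : TypeC.ω n = π * TypeC.wordProd (TypeC.wordTop n) := by
      rw [huniq π hπ, inv_mul_cancel_right]
    refine ⟨h, TypeC.isReducedExpression_of_length_le hn1 hπ.mem_Lam h ?_⟩
    have h1 := TypeC.two_mul_signedLength_ω_self (n := n)
    have h2 := TypeC.two_mul_length_wordTop n
    zify at h2
    linarith
  · have h := TypeC.ω_eq_wordProd_wordMid hi hin
    refine ⟨h, TypeC.isReducedExpression_of_length_le hn1 (TypeC.one_mem_Lam n)
      (by rw [one_mul, h]) ?_⟩
    rw [TypeC.length_wordMid hin, TypeC.signedLength_ω hin]
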